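/- Let $\sigma$ be any set of variables. A *digraph* is a finite directed graph without parallel edges. An *algebraic circuit* is an acyclic digraph whose vertices have indegree $0$ or $2$ and which has exactly one vertex of outdegree $0$; the vertices of indegree $0$ (*input gates*) are labelled with an integer or a variable, the vertices of indegree $2$ with $+$ (*addition gates*) or $\times$ (*multiplication gates*). Each vertex defines a polynomial in $\mathbb{Q}[\sigma]$: an input gate its label, an addition or multiplication gate the sum or product of the polynomials of its two parents. The circuit *computes* the polynomial defined at its vertex of outdegree $0$. A circuit is *constant-free* if all its input gates are labelled with $1$, $-1$ or a variable; it is *skew* if every multiplication gate has at least one parent that is an input gate; it is *weakly skew* if every multiplication gate $\alpha$ has at least one parent $\beta$ such that removing the edge between $\alpha$ and $\beta$ disconnects the (underlying undirected) circuit graph. The *constant-free skew* (respectively *constant-free weakly skew*) *complexity* of $f\in\mathbb{Q}[\sigma]$ is the minimal number of vertices of a constant-free skew (respectively constant-free weakly skew) circuit computing $f$. The *binary determinantal complexity* $\operatorname{bdc}(f)$ is the smallest $n$ such that $f$ is the determinant of an $n\times n$ matrix each of whose entries is $0$, $1$ or a variable. Each of these is $\infty$ if no such circuit or matrix exists. Let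 $\mathrm{VP}_s^0$, $\mathrm{VP}_{ws}^0$ and $\mathrm{DET}^0$ be the sets of all sequences $(f_m)_{m\in\mathbb{N}}$ of polynomials in $\mathbb{Q}[\sigma]$ whose constant-free skew complexity, constant-free weakly skew complexity and binary determinantal complexity, respectively, is at most $p(m)$ for all $m$, for some polynomial $p$ (depending on the sequence) with coefficients in $\mathbb{N}$. Then $$\mathrm{VP}_s^0=\mathrm{DET}^0\qquad\text{and}\qquad \mathrm{VP}_{ws}^0=\mathrm{DET}^0 .$$ -/

import Mathlib

/-- The label of a vertex `v` of an algebraic circuit with vertex set `V` and variables in `σ`: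
an input gate (of indegree 0) carries an integer or a variable; an addition or multiplication gate
(of indegree 2) records its two parents. -/
inductive Gate (σ : Type*) (V : Type*) where
  | const (c : ℤ) : Gate σ V
  | var (x : σ) : Gate σ V
  | add (a b : V) : Gate σ V
  | mul (a b : V) : Gate σ V

namespace Gate

variable {σ V : Type*}

/-- `g.HasParent u`: there is an edge from `u` to a vertex labelled `g`. -/
def HasParent : Gate σ V → V → Prop
  | const _, _ => False
  | var _, _ => False
  | add a b, u => u = a ∨ u = b
  | mul a b, u => u = a ∨ u = b

/-- Input gates. -/
def IsInput : Gate σ V → Prop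
  | const _ => True
  | var _ => True
  | add _ _ => False
  | mul _ _ => False

/-- The two parents of a vertex of indegree 2 are different (digraphs have no parallel edges). -/
def ParentsDistinct : Gate σ V → Prop
  | const _ => True
  | var _ => True
  | add a b => a ≠ b
  | mul a b => a ≠ b

/-- The input labels allowed in a constant-free circuit: `1`, `-1` and the variables. -/
def IsConstantFree : Gate σ V → Prop
  | const c => c = 1 ∨ c = -1
  | var _ => True
  | add _ _ => True
  | mul _ _ => True

/-- The polynomial defined at a gate, given the polynomials defined at its parents. -/
noncomputable def eval (g : Gate σ V) (val : (u : V) → g.HasParent u → MvPolynomial σ ℚ) :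
    MvPolynomial σ ℚ :=
  match g, val with
  | const c, _ => MvPolynomial.C (c : ℚ)
  | var x, _ => MvPolynomial.X x
  | add a b, val => val a (Or.inl rfl) + val b (Or.inr rfl)
  | mul a b, val => val a (Or.inl rfl) * val b (Or.inr rfl)

end Gate

/-- An algebraic circuit over the rational numbers in the variables `σ`: a finite acyclic digraph
(without parallel edges) whose vertices have indegree 0 or 2 and are labelled accordingly, with
exactly one vertex of outdegree 0. -/
structure AlgCircuit (σ : Type*) where
  /-- The vertices. -/
  V : Type
  fintypeV : Fintype V
  /-- The labels; they also determine the edges. -/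
  gate : V → Gate σ V
  parents_distinct : ∀ v, (gate v).ParentsDistinct
  acyclic : ∀ v, ¬ Relation.TransGen (fun u w => (gate w).HasParent u) v v
  /-- The vertex of outdegree 0. -/
  output : V
  outdegree_eq_zero_iff : ∀ v, (∀ w, ¬ (gate w).HasParent v) ↔ v = output

namespace AlgCircuit

variable {σ : Type*}

/-- There is an edge from `u` to `w`, that is, `u` is a parent of `w`. -/
def Edge (C : AlgCircuit σ) (u w : C.V) : Prop := (C.gate w).HasParent u

/-- The number of vertices. -/
def size (C : AlgCircuit σ) : ℕ := @Fintype.card C.V C.fintypeV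

theorem wellFounded_edge (C : AlgCircuit σ) : WellFounded C.Edge := by
  have := C.fintypeV
  have : IsTrans C.V (Relation.TransGen C.Edge) := ⟨fun _ _ _ => Relation.TransGen.trans⟩
  have : Std.Irrefl (Relation.TransGen C.Edge) := ⟨C.acyclic⟩
  exact Subrelation.wf (fun h => Relation.TransGen.single h)
    (Finite.wellFounded_of_trans_of_irrefl (Relation.TransGen C.Edge))

/-- The polynomial that the circuit defines at each vertex. -/
noncomputable def value (C : AlgCircuit σ) : C.V → MvPolynomial σ ℚ :=
  C.wellFounded_edge.fix fun v ih => (C.gate v).eval ih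

theorem value_eq (C : AlgCircuit σ) (v : C.V) :
    C.value v = (C.gate v).eval fun u _ => C.value u :=
  C.wellFounded_edge.fix_eq _ v

/-- `C` computes the polynomial that is defined at its vertex of outdegree 0. -/
def Computes (C : AlgCircuit σ) (f : MvPolynomial σ ℚ) : Prop := C.value C.output = f

/-- All input gates are labelled with `1`, `-1` or a variable. -/
def IsConstantFree (C : AlgCircuit σ) : Prop := ∀ v, (C.gate v).IsConstantFree

/-- Every multiplication gate has a parent that is an input gate. -/
def IsSkew (C : AlgCircuit σ) : Prop :=
  ∀ v a b, C.gate v = Gate.mul a b → (C.gate a).IsInput ∨ (C.gate b).IsInput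

/-- The circuit graph with the directions of the edges forgotten. -/
def graph (C : AlgCircuit σ) : SimpleGraph C.V := SimpleGraph.fromRel C.Edge

/-- Every multiplication gate `v` has a parent such that removing the edge between this parent
and `v` disconnects the circuit graph (which is connected, as there is only one sink). -/
def IsWeaklySkew (C : AlgCircuit σ) : Prop :=
  ∀ v a b, C.gate v = Gate.mul a b → C.graph.IsBridge s(a, v) ∨ C.graph.IsBridge s(b, v)

end AlgCircuit

/-- The constant-free skew complexity: the minimal number of vertices of a constant-free skew
circuit computing `f` (`⊤` if there is none). -/
noncomputable def skewComplexity₀ {σ : Type*} (f : MvPolynomial σ ℚ) : ℕ∞ :=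
  ⨅ (C : AlgCircuit σ) (_ : C.IsConstantFree ∧ C.IsSkew ∧ C.Computes f), (C.size : ℕ∞)

/-- The constant-free weakly skew complexity: the minimal number of vertices of a constant-free
weakly skew circuit computing `f` (`⊤` if there is none). -/
noncomputable def weaklySkewComplexity₀ {σ : Type*} (f : MvPolynomial σ ℚ) : ℕ∞ :=
  ⨅ (C : AlgCircuit σ) (_ : C.IsConstantFree ∧ C.IsWeaklySkew ∧ C.Computes f), (C.size : ℕ∞)

/-- A binary variable matrix: every entry is zero, one or a variable. -/
def IsBinaryVariableMatrix {σ : Type*} {n : ℕ}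
    (A : Matrix (Fin n) (Fin n) (MvPolynomial σ ℚ)) : Prop :=
  ∀ i j, A i j = 0 ∨ A i j = 1 ∨ ∃ x : σ, A i j = MvPolynomial.X x

/-- The binary determinantal complexity: the smallest `n` such that `f` is the determinant of an
`n × n` binary variable matrix (`⊤` if there is none). -/
noncomputable def bdc {σ : Type*} (f : MvPolynomial σ ℚ) : ℕ∞ :=
  ⨅ (n : ℕ) (A : Matrix (Fin n) (Fin n) (MvPolynomial σ ℚ))
    (_ : IsBinaryVariableMatrix A ∧ A.det = f), (n : ℕ∞)

/-- `c m` is at most the value at `m` of a fixed polynomial, for all `m`. -/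
def PolynomiallyBounded (c : ℕ → ℕ∞) : Prop :=
  ∃ p : Polynomial ℕ, ∀ m, c m ≤ ((p.eval m : ℕ) : ℕ∞)

/-- The class of sequences of polynomially bounded constant-free skew complexity. -/
def VPs₀ (σ : Type*) : Set (ℕ → MvPolynomial σ ℚ) :=
  {f | PolynomiallyBounded fun m => skewComplexity₀ (f m)}

/-- The class of sequences of polynomially bounded constant-free weakly skew complexity. -/
def VPws₀ (σ : Type*) : Set (ℕ → MvPolynomial σ ℚ) :=
  {f | PolynomiallyBounded fun m => weaklySkewComplexity₀ (f m)}

/-- The class of sequences of polynomially bounded binary determinantal complexity. -/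
def DET₀ (σ : Type*) : Set (ℕ → MvPolynomial σ ℚ) :=
  {f | PolynomiallyBounded fun m => bdc (f m)}

/-! All three models are polynomially equivalent to branching programs, here acyclic linear systems
`SkewSystem` in which every node other than the source is a combination of earlier nodes with
coefficients `0`, `±1` or a variable.

From systems to determinants (`SkewSystem.bdc_val_le`): the system is unitriangular after sorting,
so Cramer's rule gives each node value as a determinant. Doubling the nodes, so that the negative of
each value is also an unknown, removes the entries `-1`.

A skew circuit is such a system almost literally, since a product with an input gate is a scaling by
a coefficient. Weakly skew circuits need a separate argument, and do not subsume the skew ones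
because a skew circuit may share its input gates. If the edge from `p` to the product gate `w` is a
bridge and `q` is the other parent, then the ancestors of `p` influence the output only through `w`.
Their evaluation can therefore start from the value at `q` instead of from `1`, which makes the
multiplication at `w` free. The node of `v` then carries the value at `v` times the values at all
`q` whose subcircuits enclose `v` in this way (`BridgeParents.factor`).

From determinants to systems (`exists_skewSystem_of_det`): the division-free method of Samuelson and
Berkowitz computes the coefficients of `det (1 - X A)` by bordering, and each recursion is linear
with matrix entries as coefficients. From systems to circuits (`SkewSystem.exists_algCircuit`): sums
are expanded into partial sums, and each multiplication gets a private input gate, whose only edge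
is a bridge. The circuit is thus skew and weakly skew at once and serves both equalities. -/

/-! ### Branching programs as acyclic linear systems -/

/-- The possible coefficients of a skew system: `0`, `1`, `-1` and the variables. -/
def IsSkewCoeff {σ : Type*} (p : MvPolynomial σ ℚ) : Prop :=
  p = 0 ∨ p = 1 ∨ p = -1 ∨ ∃ x : σ, p = MvPolynomial.X x

/-- An algebraic branching program, written as an acyclic system of linear equations whose
coefficients are `0`, `1`, `-1` or variables. -/
structure SkewSystem (σ : Type*) where
  /-- The nodes. -/
  ι : Type
  fintypeι : Fintype ι
  /-- A topological sorting of the nodes. -/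
  rank : ι → ℕ
  /-- The polynomials computed at the nodes. -/
  val : ι → MvPolynomial σ ℚ
  /-- The source. -/
  root : ι
  val_root : val root = 1
  val_eq : ∀ i, i ≠ root → ∃ c : ι → MvPolynomial σ ℚ,
    (∀ j, IsSkewCoeff (c j) ∧ (c j ≠ 0 → rank j < rank i)) ∧ val i = ∑ j, c j * val j

attribute [instance] SkewSystem.fintypeι

namespace SkewSystem

variable {σ : Type*}

/-- The number of nodes. -/
def size (S : SkewSystem σ) : ℕ := Fintype.card S.ι

end SkewSystem

/-- A linear combination over an injectively indexed family of nodes, extended by zero to all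
nodes. -/
theorem exists_coeff_of_injective {σ ι κ : Type*} [Fintype ι] [Fintype κ] {rank : ι → ℕ}
    {val : ι → MvPolynomial σ ℚ} {N : ℕ} {p : MvPolynomial σ ℚ} (h : κ → ι)
    (hh : Function.Injective h) (l : κ → MvPolynomial σ ℚ)
    (hl : ∀ e, IsSkewCoeff (l e) ∧ rank (h e) < N) (hp : p = ∑ e, l e * val (h e)) :
    ∃ c : ι → MvPolynomial σ ℚ,
      (∀ j, IsSkewCoeff (c j) ∧ (c j ≠ 0 → rank j < N)) ∧ p = ∑ j, c j * val j := by
  classical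
  refine ⟨Function.extend h l 0, fun j => ?_, ?_⟩
  · by_cases hj : ∃ e, h e = j
    · obtain ⟨e, rfl⟩ := hj
      rw [hh.extend_apply]
      exact ⟨(hl e).1, fun _ => (hl e).2⟩
    · rw [Function.extend_apply' _ _ _ hj]
      exact ⟨Or.inl rfl, fun h0 => absurd rfl h0⟩
  · rw [hp]
    refine Finset.sum_of_injOn h hh.injOn (by simp) (fun j _ hj => ?_) (fun e _ => ?_)
    · rw [Function.extend_apply' _ _ _ (by simpa using hj)]
      simp
    · rw [hh.extend_apply]

/-! ### Branching programs as determinants -/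

/-- A matrix with ones on the diagonal and triangular support has determinant one. -/
theorem Matrix.det_eq_one_of_rank {ι R : Type*} [Fintype ι] [DecidableEq ι] [CommRing R]
    (B : Matrix ι ι R) (rank : ι → ℕ) (hd : ∀ i, B i i = 1)
    (hB : ∀ i j, i ≠ j → B i j ≠ 0 → rank j < rank i) : B.det = 1 := by
  rw [Matrix.det_apply, Finset.sum_eq_single 1]
  · simp [hd]
  · intro π _ hπ
    by_cases h0 : ∃ i, B (π i) i = 0
    · obtain ⟨i, hi⟩ := h0
      have h1 : ∏ i, B (π i) i = 0 := Finset.prod_eq_zero (Finset.mem_univ i) hi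
      exact (congrArg _ h1).trans (smul_zero _)
    · push Not at h0
      exfalso
      -- A permutation contributing to the determinant never lowers the rank. It preserves the sum
      -- of the ranks, so it preserves every rank and hence fixes every index.
      have hle : ∀ i, rank i ≤ rank (π i) := fun i => by
        by_cases h : π i = i
        · rw [h]
        · exact (hB _ _ h (h0 i)).le
      have hsum : ∑ i, rank i = ∑ i, rank (π i) := (Equiv.sum_comp π rank).symm
      have heq := (Finset.sum_eq_sum_iff_of_le (fun i _ => hle i)).1 hsum
      refine hπ (Equiv.ext fun i => ?_)
      by_contra h
      exact (hB _ _ h (h0 i)).ne (heq i (Finset.mem_univ i))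
  · simp

/-- Splits off the sign, so that only binary or variable entries remain. Zero splits as `0 - 0`,
which keeps the support and hence the triangularity. -/
theorem IsSkewCoeff.exists_sub {σ : Type*} {c : MvPolynomial σ ℚ} (hc : IsSkewCoeff c) :
    ∃ p q : MvPolynomial σ ℚ, (p = 0 ∨ p = 1 ∨ ∃ x : σ, p = MvPolynomial.X x) ∧
      (q = 0 ∨ q = 1) ∧ c = p - q ∧ (c = 0 → p = 0 ∧ q = 0) := by
  rcases hc with h | h | h | ⟨x, h⟩ <;> subst h
  · exact ⟨0, 0, by simp⟩
  · exact ⟨1, 0, by simp⟩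
  · exact ⟨0, 1, by simp⟩
  · exact ⟨MvPolynomial.X x, 0, by simp⟩

theorem bdc_le {σ ι : Type*} [Fintype ι] [DecidableEq ι] (A : Matrix ι ι (MvPolynomial σ ℚ))
    (hA : ∀ i j, A i j = 0 ∨ A i j = 1 ∨ ∃ x : σ, A i j = MvPolynomial.X x) :
    bdc A.det ≤ (Fintype.card ι : ℕ∞) := by
  refine iInf_le_of_le (Fintype.card ι) (iInf₂_le_of_le
    (A.reindex (Fintype.equivFin ι) (Fintype.equivFin ι)) ⟨fun i j => hA _ _, ?_⟩ le_rfl)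
  rw [Matrix.det_reindex_self]

/-- Cramer's rule for an integrally invertible system. -/
theorem Matrix.eq_det_updateCol_of_det_eq_one {ι R : Type*} [Fintype ι] [DecidableEq ι]
    [CommRing R] (B : Matrix ι ι R) (hB : B.det = 1) (y c : ι → R) (h : B.mulVec y = c) (i : ι) :
    y i = (B.updateCol i c).det := by
  rw [← Matrix.cramer_apply, Matrix.cramer_eq_adjugate_mulVec, ← h, Matrix.mulVec_mulVec,
    Matrix.adjugate_mul, hB, one_smul, Matrix.one_mulVec]

/-- The polynomials computed by a branching program are determinants of small binary variable
matrices. -/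
theorem SkewSystem.bdc_val_le {σ : Type*} (S : SkewSystem σ) (o : S.ι) :
    bdc (S.val o) ≤ ((2 * S.size : ℕ) : ℕ∞) := by
  classical
  have key : ∀ i, ∃ p q : S.ι → MvPolynomial σ ℚ,
      (∀ j, (p j = 0 ∨ p j = 1 ∨ ∃ x : σ, p j = MvPolynomial.X x) ∧
      (q j = 0 ∨ q j = 1) ∧ (p j ≠ 0 ∨ q j ≠ 0 → S.rank j < S.rank i)) ∧
      S.val i = (if i = S.root then 1 else 0) + ∑ j, (p j - q j) * S.val j := by
    intro i
    by_cases hi : i = S.root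
    · exact ⟨0, 0, by simp, by simp [hi, S.val_root]⟩
    · obtain ⟨c, hc, hv⟩ := S.val_eq i hi
      choose p q h1 h2 h3 h4 using fun j => (hc j).1.exists_sub
      refine ⟨p, q, fun j => ⟨h1 j, h2 j, fun h => (hc j).2 fun h0 => ?_⟩, ?_⟩
      · have := h4 j h0
        simp [this] at h
      · simp only [hi, if_false, zero_add, hv, ← h3]
  choose P Q hPQ hval using key
  have hP0 : ∀ i, P i i = 0 := fun i => by
    by_contra h
    exact lt_irrefl _ ((hPQ i i).2.2 (Or.inl h))
  have hQ0 : ∀ i, Q i i = 0 := fun i => by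
    by_contra h
    exact lt_irrefl _ ((hPQ i i).2.2 (Or.inr h))
  -- The unknown `(i, true)` stands for `-S.val i`, forced by the row with two ones. In row `(i,
  -- false)`, the positive parts `P` of the coefficients multiply the negated unknowns and the
  -- negative parts `Q` the plain ones, so no entry `-1` occurs.
  let B : Matrix (S.ι × Bool) (S.ι × Bool) (MvPolynomial σ ℚ) := fun u w =>
    if u.2 then (if u.1 = w.1 then 1 else 0)
    else if w.2 then P u.1 w.1 else if u.1 = w.1 then 1 else Q u.1 w.1
  let y : S.ι × Bool → MvPolynomial σ ℚ := fun u => if u.2 then - S.val u.1 else S.val u.1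
  let c : S.ι × Bool → MvPolynomial σ ℚ := fun u => if u = (S.root, false) then 1 else 0
  have hdet : B.det = 1 := by
    -- The negated copy of a node comes directly after the node and before all nodes of larger rank.
    refine B.det_eq_one_of_rank (fun u => 2 * S.rank u.1 + if u.2 then 1 else 0) ?_ ?_
    · rintro ⟨i, _ | _⟩ <;> simp [B]
    · rintro ⟨i, _ | _⟩ ⟨j, _ | _⟩ hne h
      · have hij : i ≠ j := fun h' => hne (by rw [h'])
        have := (hPQ i j).2.2 (Or.inr (by simpa [B, hij] using h))
        simp only [Bool.false_eq_true, if_false]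
        omega
      · have := (hPQ i j).2.2 (Or.inl (by simpa [B] using h))
        simp only [Bool.false_eq_true, if_false, if_true]
        omega
      · have hij : i = j := by
          by_contra h'
          simp [B, h'] at h
        simp [hij]
      · have hij : i = j := by
          by_contra h'
          simp [B, h'] at h
        exact absurd (by rw [hij]) hne
  have hsys : B.mulVec y = c := by
    funext ⟨i, s⟩
    rw [Matrix.mulVec, dotProduct, Fintype.sum_prod_type]
    rcases s with _ | _
    · have hQ : ∀ j, (if i = j then 1 else Q i j) = (if i = j then 1 else 0) + Q i j := fun j => by
        by_cases h : i = j
        · subst h; simp [hQ0]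
        · simp [h]
      have := hval i
      simp only [Fintype.sum_bool, B, y, c, Bool.false_eq_true, if_false, if_true, hQ,
        Prod.mk.injEq, and_true]
      simp only [add_mul, ite_mul, one_mul, zero_mul, mul_neg, Finset.sum_add_distrib,
        Finset.sum_neg_distrib, Finset.sum_ite_eq, Finset.mem_univ, if_true]
      simp only [sub_mul, Finset.sum_sub_distrib] at this
      linear_combination this
    · simp [B, y, c]
  have ho : S.val o = (B.updateCol (o, false) c).det := by
    rw [← B.eq_det_updateCol_of_det_eq_one hdet _ c hsys (o, false)]
    simp [y]
  rw [ho]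
  refine (bdc_le _ ?_).trans (by simp [size, mul_comm])
  rintro ⟨i, s⟩ u
  rw [Matrix.updateCol_apply]
  split_ifs
  · by_cases h : (i, s) = (S.root, false) <;> simp [c, h]
  · obtain ⟨j, t⟩ := u
    have h1 := (hPQ i j).1
    have h2 := (hPQ i j).2.1
    by_cases hij : i = j <;> rcases s with _ | _ <;> rcases t with _ | _ <;>
      simp only [B, hij, if_true, if_false, Bool.false_eq_true] at h1 h2 ⊢ <;> tauto

/-! ### Skew circuits as branching programs -/

namespace AlgCircuit

variable {σ : Type*} (C : AlgCircuit σ)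

attribute [instance] AlgCircuit.fintypeV

open Classical in
/-- The ancestors of a vertex, including the vertex itself. -/
noncomputable def ancestors (v : C.V) : Finset C.V :=
  Finset.univ.filter fun u => Relation.ReflTransGen C.Edge u v

variable {C}

theorem mem_ancestors {u v : C.V} : u ∈ C.ancestors v ↔ Relation.ReflTransGen C.Edge u v := by
  simp [ancestors]

theorem Edge.not_reflTransGen {u v : C.V} (h : C.Edge u v) :
    ¬ Relation.ReflTransGen C.Edge v u := fun h' =>
  C.acyclic u (Relation.TransGen.head' h h')

theorem Edge.card_ancestors_lt {u v : C.V} (h : C.Edge u v) :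
    (C.ancestors u).card < (C.ancestors v).card := by
  refine Finset.card_lt_card (Finset.ssubset_iff_of_subset ?_ |>.2
    ⟨v, mem_ancestors.2 .refl, fun h' => h.not_reflTransGen (mem_ancestors.1 h')⟩)
  exact fun w hw => mem_ancestors.2 ((mem_ancestors.1 hw).tail h)

theorem card_ancestors_pos (v : C.V) : 0 < (C.ancestors v).card :=
  Finset.card_pos.2 ⟨v, mem_ancestors.2 .refl⟩

/-- The polynomial of an input gate is a coefficient of a skew system. -/
theorem isSkewCoeff_value (hC : C.IsConstantFree) {v : C.V} (hv : (C.gate v).IsInput) :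
    IsSkewCoeff (C.value v) := by
  have h := hC v
  rw [value_eq]
  cases hg : C.gate v with
  | const c =>
    rw [hg] at h
    rcases h with h | h <;> subst h <;> simp [Gate.eval, IsSkewCoeff]
  | var x => exact Or.inr (Or.inr (Or.inr ⟨x, rfl⟩))
  | add a b => rw [hg] at hv; exact hv.elim
  | mul a b => rw [hg] at hv; exact hv.elim

theorem value_add {v a b : C.V} (h : C.gate v = .add a b) :
    C.value v = C.value a + C.value b := by
  rw [value_eq, h]
  rfl

theorem value_mul {v a b : C.V} (h : C.gate v = .mul a b) :
    C.value v = C.value a * C.value b := by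
  rw [value_eq, h]
  rfl

theorem edge_of_add {v a b : C.V} (h : C.gate v = .add a b) : C.Edge a v ∧ C.Edge b v := by
  simp [Edge, h, Gate.HasParent]

theorem edge_of_mul {v a b : C.V} (h : C.gate v = .mul a b) : C.Edge a v ∧ C.Edge b v := by
  simp [Edge, h, Gate.HasParent]

theorem gate_cases (v : C.V) : (C.gate v).IsInput ∨ (∃ a b, C.gate v = .add a b) ∨
    ∃ a b, C.gate v = .mul a b := by
  cases h : C.gate v <;> simp [Gate.IsInput]

/-- A constant-free skew circuit yields a branching program. -/
theorem bdc_le_of_isSkew (hC : C.IsConstantFree) (hs : C.IsSkew) :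
    bdc (C.value C.output) ≤ ((2 * (C.size + 1) : ℕ) : ℕ∞) := by
  classical
  let rank : Option C.V → ℕ := fun u => u.elim 0 fun v => (C.ancestors v).card
  -- The extra node `none` is the source with value `1`. An input gate is its label times this
  -- source.
  let val : Option C.V → MvPolynomial σ ℚ := fun u => u.elim 1 C.value
  let S : SkewSystem σ :=
    { ι := Option C.V
      fintypeι := inferInstance
      rank := rank
      val := val
      root := none
      val_root := rfl
      val_eq := by
        rintro (_ | v) hv
        · exact absurd rfl hv
        rcases C.gate_cases v with h | ⟨a, b, h⟩ | ⟨a, b, h⟩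
        · exact exists_coeff_of_injective (fun _ : Unit => none) (fun _ _ _ => rfl)
            (fun _ => C.value v) (fun _ => ⟨isSkewCoeff_value hC h, card_ancestors_pos v⟩)
            (by simp [val])
        · have hab : a ≠ b := by simpa [h, Gate.ParentsDistinct] using C.parents_distinct v
          refine exists_coeff_of_injective (fun i : Bool => some (if i then a else b)) ?_
            (fun _ => 1) ?_ ?_
          · rintro (_ | _) (_ | _) <;> simp [hab, hab.symm]
          · rintro (_ | _)
            · exact ⟨by simp [IsSkewCoeff], (edge_of_add h).2.card_ancestors_lt⟩
            · exact ⟨by simp [IsSkewCoeff], (edge_of_add h).1.card_ancestors_lt⟩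
          · simp [val, value_add h]
        · rcases hs v a b h with ha | hb
          · exact exists_coeff_of_injective (fun _ : Unit => some b) (fun _ _ _ => rfl)
              (fun _ => C.value a)
              (fun _ => ⟨isSkewCoeff_value hC ha, (edge_of_mul h).2.card_ancestors_lt⟩)
              (by simp [val, value_mul h])
          · exact exists_coeff_of_injective (fun _ : Unit => some a) (fun _ _ _ => rfl)
              (fun _ => C.value b)
              (fun _ => ⟨isSkewCoeff_value hC hb, (edge_of_mul h).1.card_ancestors_lt⟩)
              (by simp [val, value_mul h, mul_comm]) }
  have hS : S.size = C.size + 1 := by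
    show Fintype.card (Option C.V) = Fintype.card C.V + 1
    simp
  have := S.bdc_val_le (some C.output : Option C.V)
  rwa [hS] at this

/-! ### Bridges and sets of ancestors -/

-- By acyclicity, a path that is continued as long as possible ends in a sink, and the output is the
-- only one.
open Relation in
theorem reflTransGen_output (v : C.V) : ReflTransGen C.Edge v C.output := by
  have : IsTrans C.V (flip (TransGen C.Edge)) := ⟨fun _ _ _ h h' => h'.trans h⟩
  have : Std.Irrefl (flip (TransGen C.Edge)) := ⟨C.acyclic⟩
  induction v using (Finite.wellFounded_of_trans_of_irrefl (flip (TransGen C.Edge))).induction with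
  | _ v ih =>
    by_cases h : v = C.output
    · rw [h]
    · have := mt (C.outdegree_eq_zero_iff v).1 h
      push Not at this
      obtain ⟨w, hw⟩ := this
      exact (ih w (.single hw)).head hw

open Relation in
/-- If the edge from `a` to `v` is a bridge, then it is the only edge that leaves the set of
ancestors of `a`. -/
theorem reflTransGen_of_isBridge {a v : C.V} (hav : C.Edge a v) (hb : C.graph.IsBridge s(a, v))
    {u w : C.V} (hu : ReflTransGen C.Edge u a) (huw : C.Edge u w) :
    ReflTransGen C.Edge w a ∨ (u = a ∧ w = v) := by
  by_contra! hcon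
  obtain ⟨hwa, hne⟩ := hcon
  rw [SimpleGraph.isBridge_iff] at hb
  have step : ∀ x y, C.Edge x y → ¬ (x = a ∧ y = v) →
      (C.graph.deleteEdges {s(a, v)}).Reachable x y := by
    intro x y hxy h
    refine SimpleGraph.Adj.reachable ?_
    rw [SimpleGraph.deleteEdges_adj, graph, SimpleGraph.fromRel_adj]
    refine ⟨⟨fun h' => ?_, Or.inl hxy⟩, ?_⟩
    · subst h'
      exact hxy.not_reflTransGen .refl
    · rw [Set.mem_singleton_iff, Sym2.eq_iff]
      rintro (h' | ⟨rfl, rfl⟩)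
      · exact h h'
      · exact hav.not_reflTransGen (.single hxy)
  -- A directed path to the output that starts outside the ancestors of `a` never visits `a`, so it
  -- survives the deletion of the bridge.
  have down : ∀ x, ReflTransGen C.Edge x C.output → ReflTransGen C.Edge x a ∨
      (C.graph.deleteEdges {s(a, v)}).Reachable x C.output := by
    intro x hx
    induction hx using ReflTransGen.head_induction_on with
    | refl => exact Or.inr (.refl _)
    | @head x y hxy _ ih =>
      by_cases hxa : ReflTransGen C.Edge x a
      · exact Or.inl hxa
      rcases ih with h | h
      · exact Or.inl (h.head hxy)
      · exact Or.inr ((step x y hxy fun h' => hxa (h'.1 ▸ .refl)).trans h)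
  have up : ∀ x, ReflTransGen C.Edge x a → (C.graph.deleteEdges {s(a, v)}).Reachable x a := by
    intro x hx
    induction hx using ReflTransGen.head_induction_on with
    | refl => exact .refl _
    | head hxy hy ih =>
      refine (step _ _ hxy fun h' => ?_).trans ih
      rw [h'.2] at hy
      exact hav.not_reflTransGen hy
  have hw := (down w (reflTransGen_output w)).resolve_left hwa
  have hv := (down v (reflTransGen_output v)).resolve_left hav.not_reflTransGen
  -- A second exit `u → w` would connect `a` to `v` without the bridge, along `a`, `u`, `w`, the
  -- output, `v`.
  exact hb ((up u hu).symm.trans ((step u w huw fun h => hne h.1 h.2).trans (hw.trans hv.symm)))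

end AlgCircuit

/-! ### Weakly skew circuits as branching programs -/

namespace AlgCircuit

variable {σ : Type*} {C : AlgCircuit σ}

/-- A choice, for every multiplication gate `v`, of a parent `p v` whose edge to `v` is a bridge,
and of the other parent `q v`. -/
structure BridgeParents (C : AlgCircuit σ) where
  p : C.V → C.V
  q : C.V → C.V
  spec : ∀ v, (∃ a b, C.gate v = .mul a b) → C.Edge (p v) v ∧ C.Edge (q v) v ∧ p v ≠ q v ∧
    C.value v = C.value (p v) * C.value (q v) ∧ C.graph.IsBridge s(p v, v)

theorem IsWeaklySkew.nonempty_bridgeParents (h : C.IsWeaklySkew) :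
    Nonempty C.BridgeParents := by
  have : ∀ v, ∃ p q, (∃ a b, C.gate v = .mul a b) → C.Edge p v ∧ C.Edge q v ∧ p ≠ q ∧
      C.value v = C.value p * C.value q ∧ C.graph.IsBridge s(p, v) := by
    intro v
    by_cases hv : ∃ a b, C.gate v = .mul a b
    · obtain ⟨a, b, hab⟩ := hv
      have hne : a ≠ b := by simpa [hab, Gate.ParentsDistinct] using C.parents_distinct v
      obtain ⟨ha, hb⟩ := edge_of_mul hab
      rcases h v a b hab with h' | h'
      · exact ⟨a, b, fun _ => ⟨ha, hb, hne, value_mul hab, h'⟩⟩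
      · exact ⟨b, a, fun _ => ⟨hb, ha, hne.symm, by rw [value_mul hab, mul_comm], h'⟩⟩
    · exact ⟨v, v, fun h => absurd h hv⟩
  choose p q h using this
  exact ⟨⟨p, q, h⟩⟩

namespace BridgeParents

variable (P : C.BridgeParents)

open Relation

open Classical in
/-- The multiplication gates `w` such that `u` is an ancestor of `P.p w`. -/
noncomputable def block (u : C.V) : Finset C.V :=
  Finset.univ.filter fun w => (∃ a b, C.gate w = .mul a b) ∧ ReflTransGen C.Edge u (P.p w)

/-- The product of the values at `P.q w` for all `w ∈ P.block u`. -/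
noncomputable def factor (u : C.V) : MvPolynomial σ ℚ := ∏ w ∈ P.block u, C.value (P.q w)

open Classical in
/-- The vertices that precede `u` in an evaluation order which evaluates `P.q w` before all
ancestors of `P.p w`. -/
noncomputable def pred (u : C.V) : Finset C.V :=
  C.ancestors u ∪ (P.block u).biUnion fun w => C.ancestors (P.q w)

variable {P}

theorem mem_block {u w : C.V} : w ∈ P.block u ↔
    (∃ a b, C.gate w = .mul a b) ∧ ReflTransGen C.Edge u (P.p w) := by
  simp [block]

theorem mem_pred {u y : C.V} : y ∈ P.pred u ↔
    ReflTransGen C.Edge y u ∨ ∃ w ∈ P.block u, ReflTransGen C.Edge y (P.q w) := by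
  classical
  simp [pred, mem_ancestors]

theorem edge_p {u w : C.V} (h : w ∈ P.block u) : C.Edge (P.p w) w :=
  (P.spec w (mem_block.1 h).1).1

theorem edge_q {u w : C.V} (h : w ∈ P.block u) : C.Edge (P.q w) w :=
  (P.spec w (mem_block.1 h).1).2.1

theorem reflTransGen_of_mem_block {u w : C.V} (h : w ∈ P.block u) : ReflTransGen C.Edge u w :=
  (mem_block.1 h).2.tail (edge_p h)

theorem mem_block_of_edge {u x w : C.V} (h : w ∈ P.block u) (hux : C.Edge u x) :
    w ∈ P.block x ∨ (u = P.p w ∧ x = w) := by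
  obtain ⟨hw, hu⟩ := mem_block.1 h
  have hs := P.spec w hw
  exact (reflTransGen_of_isBridge hs.1 hs.2.2.2.2 hu hux).imp_left fun h => mem_block.2 ⟨hw, h⟩

theorem mem_block_of_reflTransGen {u x w : C.V} (h : w ∈ P.block x)
    (hux : ReflTransGen C.Edge u x) : w ∈ P.block u :=
  mem_block.2 ⟨(mem_block.1 h).1, hux.trans (mem_block.1 h).2⟩

/-- Iterates the bridge property along a path: the ancestors of `P.p w` can be left only through
`w`. -/
theorem mem_block_or_reflTransGen {u y w : C.V} (h : w ∈ P.block u)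
    (huy : ReflTransGen C.Edge u y) : w ∈ P.block y ∨ ReflTransGen C.Edge w y := by
  induction huy with
  | refl => exact Or.inl h
  | tail _ hxy ih =>
    rcases ih with ih | ih
    · rcases mem_block_of_edge ih hxy with h' | ⟨_, rfl⟩
      · exact Or.inl h'
      · exact Or.inr .refl
    · exact Or.inr (ih.tail hxy)

theorem self_notMem_block {w : C.V} : w ∉ P.block w := fun h =>
  (edge_p h).not_reflTransGen (mem_block.1 h).2

/-- The step from `P.q w` to `w` leaves no block: it could do so only along the bridge edge into
`w`, but that one starts at the other parent. -/
theorem block_q {w : C.V} (hw : ∃ a b, C.gate w = .mul a b) :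
    P.block (P.q w) = P.block w := by
  have hs := P.spec w hw
  ext w'
  refine ⟨fun h => ?_, fun h => mem_block_of_reflTransGen h (.single hs.2.1)⟩
  rcases mem_block_of_edge h hs.2.1 with h' | ⟨h1, rfl⟩
  · exact h'
  · exact absurd h1.symm hs.2.2.1

/-- The two subcircuits below a multiplication gate are disjoint: a path from `u` to `P.q w` would
stay inside the ancestors of `P.p w`, contradicting `block_q`, or pass through `w`, closing a cycle.
-/
theorem not_reflTransGen_q {u w : C.V} (h : w ∈ P.block u) :
    ¬ ReflTransGen C.Edge u (P.q w) := fun hu => by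
  rcases mem_block_or_reflTransGen h hu with h' | h'
  · rw [block_q (mem_block.1 h).1] at h'
    exact self_notMem_block h'
  · exact (edge_q h).not_reflTransGen h'

theorem card_pred_lt_of_edge {u x : C.V} (hux : C.Edge u x) :
    (P.pred u).card < (P.pred x).card := by
  refine Finset.card_lt_card (Finset.ssubset_iff_of_subset (fun y hy => ?_) |>.2
    ⟨x, mem_pred.2 (.inl .refl), fun h => ?_⟩)
  · rcases mem_pred.1 hy with h | ⟨w, hw, h⟩
    · exact mem_pred.2 (.inl (h.tail hux))
    · rcases mem_block_of_edge hw hux with h' | ⟨_, rfl⟩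
      · exact mem_pred.2 (.inr ⟨w, h', h⟩)
      · exact mem_pred.2 (.inl (h.tail (edge_q hw)))
  · rcases mem_pred.1 h with h | ⟨w, hw, h⟩
    · exact hux.not_reflTransGen h
    · exact not_reflTransGen_q hw (h.head hux)

/-- Lets the node of an input gate inside the subcircuit of `P.p w` refer to the node of `P.q w`,
although the circuit has no path between them. -/
theorem card_pred_q_lt {u w : C.V} (hw : w ∈ P.block u) :
    (P.pred (P.q w)).card < (P.pred u).card := by
  refine Finset.card_lt_card (Finset.ssubset_iff_of_subset (fun y hy => ?_) |>.2
    ⟨u, mem_pred.2 (.inl .refl), fun h => ?_⟩)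
  · rcases mem_pred.1 hy with h | ⟨w', hw', h⟩
    · exact mem_pred.2 (.inr ⟨w, hw, h⟩)
    · rw [block_q (mem_block.1 hw).1] at hw'
      exact mem_pred.2
        (.inr ⟨w', mem_block_of_reflTransGen hw' (reflTransGen_of_mem_block hw), h⟩)
  · rcases mem_pred.1 h with h | ⟨w', hw', h⟩
    · exact not_reflTransGen_q hw h
    · rw [block_q (mem_block.1 hw).1] at hw'
      exact not_reflTransGen_q
        (mem_block_of_reflTransGen hw' (reflTransGen_of_mem_block hw)) h

theorem card_pred_pos (u : C.V) : 0 < (P.pred u).card :=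
  Finset.card_pos.2 ⟨u, mem_pred.2 (.inl .refl)⟩

theorem factor_q {w : C.V} (hw : ∃ a b, C.gate w = .mul a b) :
    P.factor (P.q w) = P.factor w := by
  rw [factor, factor, block_q hw]

theorem factor_of_edge {u x : C.V} (hux : C.Edge u x) (hx : ¬ ∃ a b, C.gate x = .mul a b) :
    P.factor u = P.factor x := by
  have : P.block u = P.block x := by
    ext w
    refine ⟨fun h => ?_, fun h => mem_block_of_reflTransGen h (.single hux)⟩
    rcases mem_block_of_edge h hux with h' | ⟨_, rfl⟩
    · exact h'
    · exact absurd (mem_block.1 h).1 hx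
  rw [factor, factor, this]

/-- Exactly one block gate, `w` itself, is lost on passing from `P.p w` to `w`. Hence the nodes of
`w` and `P.p w` carry the same polynomial. -/
theorem factor_p {w : C.V} (hw : ∃ a b, C.gate w = .mul a b) :
    P.factor (P.p w) = C.value (P.q w) * P.factor w := by
  classical
  have : P.block (P.p w) = insert w (P.block w) := by
    ext w'
    rw [Finset.mem_insert]
    constructor
    · intro h
      rcases mem_block_of_edge h (P.spec w hw).1 with h' | ⟨_, rfl⟩
      · exact Or.inr h'
      · exact Or.inl rfl
    · rintro (rfl | h)
      · exact mem_block.2 ⟨hw, .refl⟩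
      · exact mem_block_of_reflTransGen h (.single (P.spec w hw).1)
  rw [factor, factor, this, Finset.prod_insert self_notMem_block]

/-- The factor of a vertex is `1` or the factor of `P.p w` for the innermost `w ∈ P.block u`. -/
theorem factor_eq_one_or (u : C.V) :
    P.factor u = 1 ∨ ∃ w ∈ P.block u, P.factor u = P.factor (P.q w) * C.value (P.q w) := by
  classical
  rcases (P.block u).eq_empty_or_nonempty with h | h
  · left
    rw [factor, h, Finset.prod_empty]
  · right
    obtain ⟨w, hw, hmin⟩ := (P.block u).exists_min_image (fun w => (C.ancestors w).card) h
    refine ⟨w, hw, ?_⟩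
    have hwm := (mem_block.1 hw).1
    rw [factor_q hwm, mul_comm, ← factor_p hwm]
    -- A gate of the block of `u` that is not in the block of `P.p w` would be an ancestor of `P.p
    -- w`, hence have fewer ancestors than the innermost gate `w`.
    have : P.block u = P.block (P.p w) := by
      ext w'
      refine ⟨fun h' => ?_, fun h' => mem_block_of_reflTransGen h' (mem_block.1 hw).2⟩
      refine (mem_block_or_reflTransGen h' (mem_block.1 hw).2).resolve_right fun hr => ?_
      refine (hmin w' h').not_gt (lt_of_le_of_lt ?_ (edge_p hw).card_ancestors_lt)
      exact Finset.card_le_card fun y hy => mem_ancestors.2 ((mem_ancestors.1 hy).trans hr)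
    rw [factor, factor, this]

end BridgeParents

/-- A constant-free weakly skew circuit yields a branching program. -/
theorem bdc_le_of_isWeaklySkew (hC : C.IsConstantFree) (hs : C.IsWeaklySkew) :
    bdc (C.value C.output) ≤ ((2 * (C.size + 1) : ℕ) : ℕ∞) := by
  classical
  obtain ⟨P⟩ := hs.nonempty_bridgeParents
  let rank : Option C.V → ℕ := fun u => u.elim 0 fun v => (P.pred v).card
  let val : Option C.V → MvPolynomial σ ℚ := fun u => u.elim 1 fun v => P.factor v * C.value v
  let S : SkewSystem σ :=
    { ι := Option C.V
      fintypeι := inferInstance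
      rank := rank
      val := val
      root := none
      val_root := rfl
      val_eq := by
        rintro (_ | v) hv
        · exact absurd rfl hv
        rcases C.gate_cases v with h | ⟨a, b, h⟩ | h
        · rcases P.factor_eq_one_or v with hf | ⟨w, hw, hf⟩
          · exact exists_coeff_of_injective (fun _ : Unit => none) (fun _ _ _ => rfl)
              (fun _ => C.value v)
              (fun _ => ⟨isSkewCoeff_value hC h, BridgeParents.card_pred_pos v⟩)
              (by simp [val, hf])
          · exact exists_coeff_of_injective (fun _ : Unit => some (P.q w)) (fun _ _ _ => rfl)
              (fun _ => C.value v)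
              (fun _ => ⟨isSkewCoeff_value hC h, BridgeParents.card_pred_q_lt hw⟩)
              (by simp [val, hf, mul_comm])
        · have hab : a ≠ b := by simpa [h, Gate.ParentsDistinct] using C.parents_distinct v
          obtain ⟨ha, hb⟩ := edge_of_add h
          have hm : ¬ ∃ a b, C.gate v = .mul a b := by simp [h]
          refine exists_coeff_of_injective (fun i : Bool => some (if i then a else b)) ?_
            (fun _ => 1) ?_ ?_
          · rintro (_ | _) (_ | _) <;> simp [hab, hab.symm]
          · rintro (_ | _)
            · exact ⟨by simp [IsSkewCoeff], BridgeParents.card_pred_lt_of_edge hb⟩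
            · exact ⟨by simp [IsSkewCoeff], BridgeParents.card_pred_lt_of_edge ha⟩
          · simp [val, value_add h, BridgeParents.factor_of_edge ha hm,
              BridgeParents.factor_of_edge hb hm, mul_add]
        · have hs := P.spec v h
          refine exists_coeff_of_injective (fun _ : Unit => some (P.p v)) (fun _ _ _ => rfl)
            (fun _ => 1)
            (fun _ => ⟨by simp [IsSkewCoeff], BridgeParents.card_pred_lt_of_edge hs.1⟩) ?_
          simp [val, BridgeParents.factor_p h, hs.2.2.2.1]
          ring }
  have hS : S.size = C.size + 1 := by
    show Fintype.card (Option C.V) = Fintype.card C.V + 1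
    simp
  -- Every vertex leads to the output, so a block gate `w` above the output would lie on a cycle.
  have h1 : P.factor C.output = 1 := by
    rcases P.factor_eq_one_or C.output with h | ⟨w, hw, _⟩
    · exact h
    · exact absurd (reflTransGen_output w)
        fun h => (BridgeParents.edge_p hw).not_reflTransGen (h.trans (BridgeParents.mem_block.1 hw).2)
  have := S.bdc_val_le (some C.output : Option C.V)
  rw [hS] at this
  simpa [S, val, h1] using this

end AlgCircuit

/-! ### A branching program for the determinant -/

/-- The determinant of a bordered matrix. -/
theorem Matrix.det_fromBlocks_replicateCol_replicateRow {ι R : Type*} [Fintype ι] [DecidableEq ι]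
    [CommRing R] [IsDomain R] (M : Matrix ι ι R) (s r : ι → R) (a : R) (hM : M.det ≠ 0) :
    (Matrix.fromBlocks M (Matrix.replicateCol Unit s) (Matrix.replicateRow Unit r)
      (Matrix.of fun _ _ => a)).det = M.det * a - r ⬝ᵥ (M.adjugate.mulVec s) := by
  -- Column elimination scaled by `M.det` to avoid division. Taking determinants leaves a factor
  -- `M.det` on both sides, cancelled at the end.
  have h : Matrix.fromBlocks M (Matrix.replicateCol Unit s) (Matrix.replicateRow Unit r)
      (Matrix.of fun _ _ => a) * Matrix.fromBlocks (1 : Matrix ι ι R)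
        (Matrix.replicateCol Unit (-(M.adjugate.mulVec s))) 0 (Matrix.of fun _ _ => M.det) =
      Matrix.fromBlocks M 0 (Matrix.replicateRow Unit r)
        (Matrix.of fun _ _ => M.det * a - r ⬝ᵥ (M.adjugate.mulVec s)) := by
    rw [Matrix.fromBlocks_multiply]
    congr 1
    · simp
    · ext i j
      have := congrFun (congrArg (fun B => Matrix.mulVec B s) M.mul_adjugate) i
      simp only [← Matrix.mulVec_mulVec, Matrix.smul_mulVec, Matrix.one_mulVec,
        Pi.smul_apply, smul_eq_mul] at this
      have h2 : (M * Matrix.replicateCol Unit (-(M.adjugate.mulVec s))) i j =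
          - (M.mulVec (M.adjugate.mulVec s)) i :=
        congrFun (Matrix.mulVec_neg (M.adjugate.mulVec s) M) i
      rw [Matrix.add_apply, h2, this]
      simp [Matrix.mul_apply, mul_comm]
    · simp
    · ext i j
      have h2 : (Matrix.replicateRow Unit r * Matrix.replicateCol Unit (-(M.adjugate.mulVec s))) i j
          = - (r ⬝ᵥ (M.adjugate.mulVec s)) := by
        rw [← dotProduct_neg]
        rfl
      rw [Matrix.add_apply, h2]
      simp [Matrix.mul_apply]
      ring
  have h2 := congrArg Matrix.det h
  rw [Matrix.det_mul, Matrix.det_fromBlocks_zero₂₁, Matrix.det_fromBlocks_zero₁₂,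
    Matrix.det_one, one_mul, Matrix.det_unique (n := Unit), Matrix.det_unique (n := Unit),
    mul_comm] at h2
  exact mul_left_cancel₀ hM h2

namespace Matrix

open Polynomial

variable {R : Type*} [CommRing R]

/-- The leading principal submatrix of size `k` of an infinite matrix. -/
def leading (A : ℕ → ℕ → R) (k : ℕ) : Matrix (Fin k) (Fin k) R := fun i j => A i j

/-- The vector `-adj(1 - X Aₖ) s`, where `Aₖ` is the leading principal submatrix of size `k` and
`s` the part of the next column above the diagonal. -/
noncomputable def negAdjCol (A : ℕ → ℕ → R) (k : ℕ) : Fin k → R[X] :=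
  -((1 - (X : R[X]) • (leading A k).map C).adjugate.mulVec fun i => C (A i k))

/-- This is `M * adj M = det M` for `M = 1 - X Aₖ`, applied to the column `s`. Since `X` shifts
degrees, coefficients of the vector are determined by those of lower degree. -/
theorem negAdjCol_apply (A : ℕ → ℕ → R) (k : ℕ) (i : Fin k) :
    negAdjCol A k i = - (C (A i k) * (leading A k).charpolyRev) +
      X * ∑ j : Fin k, C (A i j) * negAdjCol A k j := by
  have h := congrArg (fun B => B.mulVec fun i : Fin k => C (A i k))
    (1 - (X : R[X]) • (leading A k).map C).mul_adjugate
  have h2 := congrFun h i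
  simp only [← Matrix.mulVec_mulVec, Matrix.smul_mulVec, Matrix.one_mulVec, Matrix.sub_mulVec,
    Pi.smul_apply, smul_eq_mul, Pi.sub_apply] at h2
  rw [Matrix.charpolyRev]
  simp only [negAdjCol, Pi.neg_apply, mul_neg, Finset.sum_neg_distrib]
  have h3 : ((leading A k).map C).mulVec ((1 - (X : R[X]) • (leading A k).map C).adjugate.mulVec
      fun i => C (A i k)) i = ∑ j : Fin k, C (A i j) *
        ((1 - (X : R[X]) • (leading A k).map C).adjugate.mulVec fun i => C (A i k)) j := rfl
  rw [h3] at h2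
  linear_combination -h2

/-- The bordered determinant formula for `1 - X Aₖ₊₁`. The sign built into `negAdjCol` makes the
entries `A k i` themselves, not their negatives, the coefficients of the last sum. -/
theorem charpolyRev_leading_succ [IsDomain R] (A : ℕ → ℕ → R) (k : ℕ) :
    (leading A (k + 1)).charpolyRev = (leading A k).charpolyRev -
      X * (C (A k k) * (leading A k).charpolyRev) +
      X * (X * ∑ i : Fin k, C (A k i) * negAdjCol A k i) := by
  set M := 1 - (X : R[X]) • (leading A k).map C with hM
  -- At `X = 0` this determinant is `1`.
  have hd : M.det ≠ 0 := by
    intro h0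
    have h1 := Matrix.eval_charpolyRev (M := leading A k)
    rw [Matrix.charpolyRev, ← hM, h0] at h1
    simp at h1
  let e : Fin k ⊕ Unit ≃ Fin (k + 1) :=
    (Equiv.sumCongr (Equiv.refl _) (Equiv.ofUnique Unit (Fin 1))).trans finSumFinEquiv
  have h := M.det_fromBlocks_replicateCol_replicateRow (fun i => - (X * C (A i k)))
    (fun i => - (X * C (A k i))) (1 - X * C (A k k)) hd
  have h2 : (leading A (k + 1)).charpolyRev = (Matrix.fromBlocks M
      (Matrix.replicateCol Unit fun i : Fin k => - (X * C (A i k)))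
      (Matrix.replicateRow Unit fun i : Fin k => - (X * C (A k i)))
      (Matrix.of fun _ _ => 1 - X * C (A k k))).det := by
    rw [Matrix.charpolyRev, ← Matrix.det_submatrix_equiv_self e]
    congr 1
    ext1 i j
    have hl : ∀ i : Fin k, e (Sum.inl i) = i.castSucc := fun i => rfl
    have hr : ∀ i, e (Sum.inr i) = Fin.last k := fun i => by
      ext; simp [e]
    rcases i with i | i <;> rcases j with j | j
    · simp [hl, hM, leading, Matrix.one_apply]
    · simp [hl, hr, leading, (Fin.castSucc_lt_last i).ne]
    · simp [hl, hr, leading, (Fin.castSucc_lt_last j).ne']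
    · simp [hr, leading]
  rw [h2, h]
  have h3 : M.adjugate.mulVec (fun i => - (X * C (A i k))) = fun i => X * negAdjCol A k i := by
    have : (fun i : Fin k => - (X * C (A i k))) = (-X : R[X]) • fun i : Fin k => C (A i k) := by
      ext1 i; simp
    rw [this, Matrix.mulVec_smul]
    ext1 i
    simp [negAdjCol, hM]
  rw [h3, dotProduct, Matrix.charpolyRev, ← hM, Finset.mul_sum, Finset.mul_sum, sub_eq_add_neg _ (Finset.sum _ _), ← Finset.sum_neg_distrib]
  congr 1
  · ring
  · refine Finset.sum_congr rfl fun i _ => ?_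
    ring

theorem coeff_charpolyRev_card {n : ℕ} (M : Matrix (Fin n) (Fin n) R) :
    M.det = (-1) ^ n * M.charpolyRev.coeff n := by
  nontriviality R
  rw [Matrix.det_eq_sign_charpoly_coeff, Fintype.card_fin, ← Matrix.reverse_charpoly,
    Polynomial.coeff_reverse, Matrix.charpoly_natDegree_eq_dim, Fintype.card_fin,
    Polynomial.revAt_le le_rfl, Nat.sub_self]

end Matrix

namespace DetProgram

open Matrix

variable {σ : Type*} (A : ℕ → ℕ → MvPolynomial σ ℚ) (n : ℕ)

/-- The nodes of the branching program for the determinant: for `k, j ≤ n`, the `j`-th coefficients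
of the reverse characteristic polynomial of the leading submatrix of size `k`, of its negative, and
of the entries of the vector `Matrix.negAdjCol`. -/
abbrev Node := Fin (n + 1) × Fin (n + 1) × (Bool ⊕ Fin n)

/-- A topological sorting of the nodes. -/
def rank : Node n → ℕ
  | (k, _, .inl false) => k * (n + 3)
  | (k, _, .inl true) => k * (n + 3) + 1
  | (k, j, .inr _) => k * (n + 3) + 2 + j

/-- The polynomials at the nodes. -/
noncomputable def val : Node n → MvPolynomial σ ℚ
  | (k, j, .inl false) => (leading A k).charpolyRev.coeff j
  | (k, j, .inl true) => - (leading A k).charpolyRev.coeff j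
  | (k, j, .inr i) => if h : (i : ℕ) < k then (negAdjCol A k ⟨i, h⟩).coeff j else 0

theorem charpolyRev_leading_zero : (leading A 0).charpolyRev = 1 := by
  simp [charpolyRev]

variable {A n}

theorem exists_coeff_inl_false (hA : ∀ i j, IsSkewCoeff (A i j)) (k j : Fin (n + 1))
    (hkj : (k, j) ≠ (0, 0)) : ∃ c : Node n → MvPolynomial σ ℚ,
      (∀ v, IsSkewCoeff (c v) ∧ (c v ≠ 0 → rank n v < rank n (k, j, .inl false))) ∧
      val A n (k, j, .inl false) = ∑ v, c v * val A n v := by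
  obtain ⟨k, hk⟩ := k
  obtain ⟨j, hj⟩ := j
  have h1 : IsSkewCoeff (1 : MvPolynomial σ ℚ) := by simp [IsSkewCoeff]
  rcases k with _ | k
  · rcases j with _ | j
    · exact absurd rfl hkj
    · refine ⟨0, by simp [IsSkewCoeff], ?_⟩
      simp [val, charpolyRev_leading_zero, Polynomial.coeff_one]
  have hk' : k < n + 1 := by omega
  -- The ranks at level `k` go up to `k * (n + 3) + 2 + n`, so the stride `n + 3` puts each level
  -- after the previous one.
  have hmul : (k + 1) * (n + 3) = k * (n + 3) + n + 3 := by ring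
  rcases j with _ | _ | j
  · refine exists_coeff_of_injective (fun _ : Unit => (⟨k, hk'⟩, ⟨0, hj⟩, .inl false))
      (fun _ _ _ => rfl) (fun _ => 1) (fun _ => ⟨h1, ?_⟩) ?_
    · simp only [rank]
      omega
    · simp [val, charpolyRev_leading_succ]
  -- The coefficient `-A k k` is not allowed when the entry is a variable; the entry multiplies the
  -- node of the negated polynomial instead.
  · refine exists_coeff_of_injective
      (fun b : Bool => (⟨k, hk'⟩, if b then ⟨0, by omega⟩ else ⟨1, hj⟩, .inl b))
      ?_ (fun b => if b then A k k else 1) ?_ ?_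
    · intro b b' h
      simpa using congrArg (fun v => v.2.2) h
    · rintro (_ | _)
      · refine ⟨h1, ?_⟩
        simp only [rank]
        omega
      · refine ⟨hA _ _, ?_⟩
        simp only [rank]
        omega
    · simp [val, charpolyRev_leading_succ, Polynomial.coeff_X_mul, Polynomial.mul_coeff_zero]
      ring
  · refine exists_coeff_of_injective (κ := Bool ⊕ Fin k)
      (Sum.elim (fun b => (⟨k, hk'⟩, if b then ⟨j + 1, by omega⟩ else ⟨j + 2, hj⟩, .inl b))
        (fun i => (⟨k, hk'⟩, ⟨j, by omega⟩, .inr (i.castLE (by omega)))))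
      ?_ (Sum.elim (fun b => if b then A k k else 1) (fun i => A k i)) ?_ ?_
    · rintro (b | i) (b' | i') h
      · simpa using congrArg (fun v => v.2.2) h
      · simp at h
      · simp at h
      · simpa using congrArg (fun v => v.2.2) h
    · rintro ((_ | _) | i)
      · refine ⟨h1, ?_⟩
        simp only [rank, Sum.elim_inl]
        omega
      · refine ⟨hA _ _, ?_⟩
        simp only [rank, Sum.elim_inl]
        omega
      · refine ⟨hA _ _, ?_⟩
        simp only [rank, Sum.elim_inr]
        omega
    · simp [val, charpolyRev_leading_succ, Polynomial.coeff_X_mul]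
      ring

theorem exists_coeff_inl_true (k j : Fin (n + 1)) : ∃ c : Node n → MvPolynomial σ ℚ,
      (∀ v, IsSkewCoeff (c v) ∧ (c v ≠ 0 → rank n v < rank n (k, j, .inl true))) ∧
      val A n (k, j, .inl true) = ∑ v, c v * val A n v :=
  exists_coeff_of_injective (fun _ : Unit => (k, j, .inl false)) (fun _ _ _ => rfl) (fun _ => -1)
    (fun _ => ⟨by simp [IsSkewCoeff], by simp [rank]⟩) (by simp [val])

theorem exists_coeff_inr (hA : ∀ i j, IsSkewCoeff (A i j)) (k j : Fin (n + 1)) (i : Fin n) :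
    ∃ c : Node n → MvPolynomial σ ℚ,
      (∀ v, IsSkewCoeff (c v) ∧ (c v ≠ 0 → rank n v < rank n (k, j, .inr i))) ∧
      val A n (k, j, .inr i) = ∑ v, c v * val A n v := by
  by_cases hi : (i : ℕ) < k
  swap
  · exact ⟨0, by simp [IsSkewCoeff], by simp [val, hi]⟩
  obtain ⟨k, hk⟩ := k
  obtain ⟨j, hj⟩ := j
  have hi' : (i : ℕ) < k := hi
  rcases j with _ | j
  · refine exists_coeff_of_injective (fun _ : Unit => (⟨k, hk⟩, ⟨0, hj⟩, .inl true))
      (fun _ _ _ => rfl) (fun _ => A i k) (fun _ => ⟨hA _ _, ?_⟩) ?_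
    · simp only [rank]
      omega
    · simp only [val, hi', dif_pos]
      rw [negAdjCol_apply]
      simp
  · refine exists_coeff_of_injective (κ := Unit ⊕ Fin k)
      (Sum.elim (fun _ => (⟨k, hk⟩, ⟨j + 1, hj⟩, .inl true))
        (fun i' => (⟨k, hk⟩, ⟨j, by omega⟩, .inr (i'.castLE (by omega)))))
      ?_ (Sum.elim (fun _ => A i k) (fun i' => A i i')) ?_ ?_
    · rintro (b | i) (b' | i') h
      · rfl
      · simp at h
      · simp at h
      · simpa using congrArg (fun v => v.2.2) h
    · rintro (_ | i')
      · refine ⟨hA _ _, ?_⟩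
        simp only [rank, Sum.elim_inl]
        omega
      · refine ⟨hA _ _, ?_⟩
        simp only [rank, Sum.elim_inr]
        omega
    · simp only [val, hi', dif_pos]
      rw [negAdjCol_apply]
      simp [Polynomial.coeff_X_mul]

end DetProgram

/-- The branching program for the leading principal minors of `A`, after Samuelson and
Berkowitz. -/
noncomputable def DetProgram.system {σ : Type*} (A : ℕ → ℕ → MvPolynomial σ ℚ) (n : ℕ)
    (hA : ∀ i j, IsSkewCoeff (A i j)) : SkewSystem σ where
  ι := Node n
  fintypeι := inferInstance
  rank := rank n
  val := val A n
  root := (0, 0, .inl false)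
  val_root := by
    show (Matrix.leading A 0).charpolyRev.coeff 0 = 1
    simp [charpolyRev_leading_zero]
  val_eq := by
    rintro ⟨k, j, (_ | _) | i⟩ h
    · exact exists_coeff_inl_false hA k j fun h' => h (by rw [Prod.mk.injEq] at h'; rw [h'.1, h'.2])
    · exact exists_coeff_inl_true k j
    · exact exists_coeff_inr hA k j i

/-- The determinant of a binary variable matrix is computed by a small branching program. -/
theorem exists_skewSystem_of_det {σ : Type*} {n : ℕ}
    {A : Matrix (Fin n) (Fin n) (MvPolynomial σ ℚ)} (hA : IsBinaryVariableMatrix A) :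
    ∃ (S : SkewSystem σ) (o : S.ι), S.val o = A.det ∧ S.size = (n + 1) * ((n + 1) * (n + 2)) := by
  let A' : ℕ → ℕ → MvPolynomial σ ℚ := fun i j =>
    if h : i < n ∧ j < n then A ⟨i, h.1⟩ ⟨j, h.2⟩ else 0
  have hA' : ∀ i j, IsSkewCoeff (A' i j) := by
    intro i j
    by_cases h : i < n ∧ j < n
    · rcases hA ⟨i, h.1⟩ ⟨j, h.2⟩ with h' | h' | h' <;> simp only [A', h, IsSkewCoeff] <;> simp [h']
    · simp [A', h, IsSkewCoeff]
  have hl : Matrix.leading A' n = A := by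
    ext1 i j
    simp [Matrix.leading, A']
  have hsize : (DetProgram.system A' n hA').size = (n + 1) * ((n + 1) * (n + 2)) := by
    show Fintype.card (DetProgram.Node n) = _
    simp
    ring
  have hdet := Matrix.coeff_charpolyRev_card A
  -- The sign `(-1) ^ n` decides between the node of the top coefficient and that of its negative.
  rcases n.even_or_odd with hn | hn
  · refine ⟨_, (Fin.last n, Fin.last n, .inl false), ?_, hsize⟩
    rw [hdet, hn.neg_one_pow, one_mul]
    show (Matrix.leading A' n).charpolyRev.coeff n = _
    rw [hl]
  · refine ⟨_, (Fin.last n, Fin.last n, .inl true), ?_, hsize⟩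
    rw [hdet, hn.neg_one_pow, neg_one_mul]
    show - (Matrix.leading A' n).charpolyRev.coeff n = _
    rw [hl]

/-! ### From branching programs to circuits -/

namespace Gate

variable {σ V W : Type*}

/-- Renaming of the parents. -/
def map (f : V → W) : Gate σ V → Gate σ W
  | const c => const c
  | var x => var x
  | add a b => add (f a) (f b)
  | mul a b => mul (f a) (f b)

theorem hasParent_map {f : V → W} (hf : Function.Injective f) (g : Gate σ V) (u : V) :
    (g.map f).HasParent (f u) ↔ g.HasParent u := by
  cases g <;> simp [map, HasParent, hf.eq_iff]

theorem isInput_map (f : V → W) (g : Gate σ V) : (g.map f).IsInput ↔ g.IsInput := by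
  cases g <;> rfl

theorem isConstantFree_map (f : V → W) (g : Gate σ V) :
    (g.map f).IsConstantFree ↔ g.IsConstantFree := by
  cases g <;> rfl

theorem ParentsDistinct.of_map {f : V → W} {g : Gate σ V} (h : (g.map f).ParentsDistinct) :
    g.ParentsDistinct := by
  cases g with
  | const c => trivial
  | var x => trivial
  | add a b => exact fun h' => h (congrArg f h')
  | mul a b => exact fun h' => h (congrArg f h')

theorem eval_map (f : V → W) (g : Gate σ V) (val : W → MvPolynomial σ ℚ) :
    (g.map f).eval (fun u _ => val u) = g.eval fun u _ => val (f u) := by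
  cases g <;> rfl

theorem exists_map_val_eq {p : V → Prop} (g : Gate σ V) (h : ∀ u, g.HasParent u → p u) :
    ∃ g' : Gate σ (Subtype p), g'.map Subtype.val = g := by
  cases g with
  | const c => exact ⟨const c, rfl⟩
  | var x => exact ⟨var x, rfl⟩
  | add a b => exact ⟨add ⟨a, h a (Or.inl rfl)⟩ ⟨b, h b (Or.inr rfl)⟩, rfl⟩
  | mul a b => exact ⟨mul ⟨a, h a (Or.inl rfl)⟩ ⟨b, h b (Or.inr rfl)⟩, rfl⟩

theorem eval_congr (g : Gate σ V) {val val' : (u : V) → g.HasParent u → MvPolynomial σ ℚ}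
    (h : ∀ u hu, val u hu = val' u hu) : g.eval val = g.eval val' := by
  have : val = val' := funext fun u => funext fun hu => h u hu
  rw [this]

theorem IsInput.not_hasParent {g : Gate σ V} (h : g.IsInput) (u : V) : ¬ g.HasParent u := by
  cases g <;> simp_all [IsInput, HasParent]

end Gate

open Relation in
/-- A system of gates in which every multiplication gate has a private input gate becomes a skew
and weakly skew circuit for a given vertex after removing all vertices which are not ancestors of
that vertex. -/
theorem exists_algCircuit_of_gates {σ : Type*} {W : Type} [Fintype W] (gate : W → Gate σ W)
    (rank : W → ℕ) (hrank : ∀ u w, (gate w).HasParent u → rank u < rank w)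
    (hd : ∀ w, (gate w).ParentsDistinct) (hc : ∀ w, (gate w).IsConstantFree)
    (hm : ∀ w a b, gate w = .mul a b → (gate a).IsInput ∧ ∀ w', (gate w').HasParent a → w' = w)
    (val : W → MvPolynomial σ ℚ) (hval : ∀ w, val w = (gate w).eval fun u _ => val u) (o : W) :
    ∃ C : AlgCircuit σ, C.IsConstantFree ∧ C.IsSkew ∧ C.IsWeaklySkew ∧ C.Computes (val o) ∧
      C.size ≤ Fintype.card W := by
  classical
  let p : W → Prop := fun w => ReflTransGen (fun u w => (gate w).HasParent u) w o
  have hex : ∀ w : Subtype p, ∃ g : Gate σ (Subtype p), g.map Subtype.val = gate w :=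
    fun w => Gate.exists_map_val_eq _ fun u hu => ReflTransGen.head hu w.2
  choose g hg using hex
  have hpar : ∀ u w : Subtype p, (g w).HasParent u ↔ (gate w).HasParent u := fun u w => by
    rw [← hg w, Gate.hasParent_map Subtype.val_injective]
  have hlt : ∀ u w : Subtype p, TransGen (fun u w => (g w).HasParent u) u w →
      rank u < rank w := by
    intro u w h
    induction h with
    | single h => exact hrank _ _ ((hpar _ _).1 h)
    | tail _ h ih => exact ih.trans (hrank _ _ ((hpar _ _).1 h))
  have hle : ∀ w, p w → rank w ≤ rank o := by
    intro w h
    induction h using ReflTransGen.head_induction_on with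
    | refl => exact le_rfl
    | head h _ ih => exact (hrank _ _ h).le.trans ih
  let C : AlgCircuit σ :=
    { V := Subtype p
      fintypeV := inferInstance
      gate := g
      parents_distinct := fun w => Gate.ParentsDistinct.of_map (f := Subtype.val)
        (by rw [hg w]; exact hd w)
      acyclic := fun w h => lt_irrefl _ (hlt w w h)
      output := ⟨o, .refl⟩
      outdegree_eq_zero_iff := by
        intro w
        constructor
        · intro h
          rcases ReflTransGen.cases_head w.2 with h' | ⟨x, hx, hxo⟩
          · exact Subtype.ext h'
          · exact absurd ((hpar w ⟨x, hxo⟩).2 hx) (h ⟨x, hxo⟩)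
        · rintro rfl x hx
          exact ((hle x x.2).trans_lt (hrank _ _ ((hpar _ _).1 hx))).false }
  have hmul : ∀ (v a b : Subtype p), g v = .mul a b →
      (g a).IsInput ∧ ∀ w, (g w).HasParent a → w = v := by
    intro v a b h
    have h1 : gate v = .mul a b := by rw [← hg v, h]; rfl
    obtain ⟨h2, h3⟩ := hm _ _ _ h1
    rw [← hg a, Gate.isInput_map] at h2
    exact ⟨h2, fun w hw => Subtype.ext (h3 w ((hpar _ _).1 hw))⟩
  have hvalue : ∀ w : C.V, C.value w = val w.1 := by
    intro w
    induction w using C.wellFounded_edge.induction with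
    | _ w ih =>
      rw [C.value_eq, hval w.1, ← hg w, Gate.eval_map]
      exact Gate.eval_congr _ fun u hu => ih u hu
  refine ⟨C, fun w => ?_, fun v a b h => Or.inl (hmul v a b h).1, fun v a b h => Or.inl ?_,
    hvalue _, Fintype.card_subtype_le p⟩
  · have := hc w.1
    rw [← hg w, Gate.isConstantFree_map] at this
    exact this
  · obtain ⟨h1, h2⟩ := hmul v a b h
    have hedge : C.Edge a v := (AlgCircuit.edge_of_mul h).1
    rw [SimpleGraph.isBridge_iff]
    rintro ⟨w⟩
    -- The input gate `a` has `v` as its only neighbour, so it is isolated once the edge is deleted.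
    cases w with
    | nil => exact hedge.not_reflTransGen .refl
    | cons hadj _ =>
      rw [SimpleGraph.deleteEdges_adj, AlgCircuit.graph, SimpleGraph.fromRel_adj] at hadj
      obtain ⟨⟨_, h3 | h3⟩, h4⟩ := hadj
      · exact h4 (by rw [h2 _ h3]; rfl)
      · exact h1.not_hasParent _ h3

/-- The labels of the input gates of constant-free circuits. -/
def IsInputLabel {σ : Type*} (p : MvPolynomial σ ℚ) : Prop :=
  p = 1 ∨ p = -1 ∨ ∃ x : σ, p = MvPolynomial.X x

theorem IsSkewCoeff.isInputLabel {σ : Type*} {p : MvPolynomial σ ℚ} (h : IsSkewCoeff p)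
    (h0 : p ≠ 0) : IsInputLabel p :=
  h.resolve_left h0

theorem IsInputLabel.exists_gate {σ V : Type*} {p : MvPolynomial σ ℚ} (h : IsInputLabel p) :
    ∃ g : Gate σ V, g.IsInput ∧ g.IsConstantFree ∧ ∀ val, g.eval val = p := by
  rcases h with rfl | rfl | ⟨x, rfl⟩
  · exact ⟨.const 1, trivial, Or.inl rfl, fun _ => by simp [Gate.eval]⟩
  · exact ⟨.const (-1), trivial, Or.inr rfl, fun _ => by simp [Gate.eval]⟩
  · exact ⟨.var x, trivial, trivial, fun _ => rfl⟩

/-- A straight-line program, in which all multiplications are multiplications by a label, yields a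
circuit that is both skew and weakly skew. -/
theorem exists_algCircuit_of_program {σ : Type*} {V : Type} [Fintype V] (rank : V → ℕ)
    (val : V → MvPolynomial σ ℚ)
    (h : ∀ v, IsInputLabel (val v) ∨
      (∃ a b, a ≠ b ∧ rank a < rank v ∧ rank b < rank v ∧ val v = val a + val b) ∨
      ∃ l a, IsInputLabel l ∧ rank a < rank v ∧ val v = l * val a) (o : V) :
    ∃ C : AlgCircuit σ, C.IsConstantFree ∧ C.IsSkew ∧ C.IsWeaklySkew ∧ C.Computes (val o) ∧
      C.size ≤ 2 * Fintype.card V := by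
  -- The right copy of `V` holds the private input gate `l v` for the label multiplied at `v`; if
  -- `v` is no multiplication, it is a filler without children.
  have key : ∀ v, ∃ (g l : Gate σ (V ⊕ V)) (p : MvPolynomial σ ℚ),
      (l.IsInput ∧ l.IsConstantFree ∧ ∀ x, l.eval x = p) ∧ g.IsConstantFree ∧
      ((g.IsInput ∧ ∀ x, g.eval x = val v) ∨
        (∃ a b, g = .add (.inl a) (.inl b) ∧ a ≠ b ∧ rank a < rank v ∧ rank b < rank v ∧
          val v = val a + val b) ∨
        ∃ a, g = .mul (.inr v) (.inl a) ∧ rank a < rank v ∧ val v = p * val a) := by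
    intro v
    have h1 : IsInputLabel (1 : MvPolynomial σ ℚ) := Or.inl rfl
    rcases h v with hv | ⟨a, b, hv⟩ | ⟨l, a, hl, hv⟩
    · obtain ⟨g, hg⟩ := hv.exists_gate (V := V ⊕ V)
      exact ⟨g, g, _, hg, hg.2.1, Or.inl ⟨hg.1, hg.2.2⟩⟩
    · obtain ⟨g, hg⟩ := h1.exists_gate (V := V ⊕ V)
      exact ⟨.add (.inl a) (.inl b), g, 1, hg, trivial, Or.inr (Or.inl ⟨a, b, rfl, hv⟩)⟩
    · obtain ⟨g, hg⟩ := hl.exists_gate (V := V ⊕ V)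
      exact ⟨.mul (.inr v) (.inl a), g, l, hg, trivial, Or.inr (Or.inr ⟨a, rfl, hv⟩)⟩
  choose g l p hl hc hg using key
  have hcard : Fintype.card (V ⊕ V) = 2 * Fintype.card V := by
    rw [Fintype.card_sum, two_mul]
  rw [← hcard]
  refine exists_algCircuit_of_gates (Sum.elim g l) (Sum.elim (fun v => rank v + 1) fun _ => 0)
    ?_ ?_ ?_ ?_ (Sum.elim val p) ?_ (.inl o)
  · rintro u (v | v) hu
    · rcases hg v with ⟨h1, _⟩ | ⟨a, b, h1, h2⟩ | ⟨a, h1, h2⟩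
      · exact absurd hu (h1.not_hasParent u)
      · rw [Sum.elim_inl, h1] at hu
        rcases hu with rfl | rfl <;> simp [h2.2.1, h2.2.2.1]
      · rw [Sum.elim_inl, h1] at hu
        rcases hu with rfl | rfl <;> simp [h2.1]
    · exact absurd hu ((hl v).1.not_hasParent u)
  · rintro (v | v)
    · rcases hg v with ⟨h1, _⟩ | ⟨a, b, h1, h2⟩ | ⟨a, h1, h2⟩
      · rw [Sum.elim_inl]
        cases hgv : g v <;> simp_all [Gate.IsInput, Gate.ParentsDistinct]
      · rw [Sum.elim_inl, h1]
        exact fun h' => h2.1 (Sum.inl_injective h')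
      · rw [Sum.elim_inl, h1]
        exact Sum.inr_ne_inl
    · have := (hl v).1
      rw [Sum.elim_inr]
      cases hgv : l v <;> simp_all [Gate.IsInput, Gate.ParentsDistinct]
  · rintro (v | v)
    · exact hc v
    · exact (hl v).2.1
  · rintro (v | v) a b h'
    · rw [Sum.elim_inl] at h'
      rcases hg v with ⟨h1, _⟩ | ⟨a', b', h1, h2⟩ | ⟨a', h1, h2⟩
      · rw [h'] at h1
        exact h1.elim
      · rw [h1] at h'
        simp at h'
      · rw [h1, Gate.mul.injEq] at h'
        obtain ⟨rfl, rfl⟩ := h'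
        refine ⟨(hl v).1, ?_⟩
        rintro (w | w) hw
        · rcases hg w with ⟨h3, _⟩ | ⟨a'', b'', h3, _⟩ | ⟨a'', h3, _⟩
          · exact absurd hw (h3.not_hasParent _)
          · rw [Sum.elim_inl, h3] at hw
            simp [Gate.HasParent] at hw
          · rw [Sum.elim_inl, h3] at hw
            simp only [Gate.HasParent, Sum.inr.injEq, reduceCtorEq, or_false] at hw
            rw [hw]
        · exact absurd hw ((hl w).1.not_hasParent _)
    · rw [Sum.elim_inr] at h'
      have := (hl v).1
      rw [h'] at this
      exact this.elim
  · rintro (v | v)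
    · rcases hg v with ⟨_, h1⟩ | ⟨a, b, h1, h2⟩ | ⟨a, h1, h2⟩
      · exact (h1 _).symm
      · simp only [Sum.elim_inl]
        rw [h1, h2.2.2.2]
        rfl
      · simp only [Sum.elim_inl]
        rw [h1, h2.2]
        rfl
    · exact ((hl v).2.2 _).symm

/-- The polynomials computed by a branching program have small circuits which are both skew and
weakly skew. -/
theorem SkewSystem.exists_algCircuit {σ : Type*} (S : SkewSystem σ) (o : S.ι) :
    ∃ C : AlgCircuit σ, C.IsConstantFree ∧ C.IsSkew ∧ C.IsWeaklySkew ∧ C.Computes (S.val o) ∧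
      C.size ≤ 2 * (S.size * (S.size + 1) + S.size * S.size + 3) := by
  classical
  set N := S.size with hN
  let e : Fin N ≃ S.ι := (Fintype.equivFin S.ι).symm
  have key : ∀ i, ∃ c : S.ι → MvPolynomial σ ℚ,
      (∀ j, IsSkewCoeff (c j) ∧ (c j ≠ 0 → S.rank j < S.rank i)) ∧
      (i ≠ S.root → S.val i = ∑ j, c j * S.val j) := by
    intro i
    by_cases hi : i = S.root
    · exact ⟨0, by simp [IsSkewCoeff], fun h => absurd hi h⟩
    · obtain ⟨c, h1, h2⟩ := S.val_eq i hi
      exact ⟨c, h1, fun _ => h2⟩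
  choose c hc hval using key
  let term : S.ι → ℕ → MvPolynomial σ ℚ := fun i j =>
    if h : j < N then c i (e ⟨j, h⟩) * S.val (e ⟨j, h⟩) else 0
  let V : Type := ((S.ι × Fin (N + 1)) ⊕ (S.ι × Fin N)) ⊕ Option Bool
  let val : V → MvPolynomial σ ℚ := Sum.elim (Sum.elim
    (fun u => if u.1 = S.root then 1 else ∑ j ∈ Finset.range u.2, term u.1 j)
    (fun u => if c u.1 (e u.2) = 0 then 1 else c u.1 (e u.2) * S.val (e u.2)))
    (fun b => b.elim 0 fun b => if b then 1 else -1)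
  -- A term follows the full sum at its own node `j`, of rank `S.rank j * (N + 1) + N + 2`, and
  -- precedes the sums at later nodes that use it. The offset `2` leaves room for `±1` at rank `0`
  -- and for `0 = 1 + (-1)` at rank `1`.
  let rank : V → ℕ := Sum.elim (Sum.elim
    (fun u => S.rank u.1 * (N + 1) + u.2 + 2)
    (fun u => S.rank (e u.2) * (N + 1) + N + 3))
    (fun b => b.elim 1 fun _ => 0)
  have hlast : ∀ i, val (.inl (.inl (i, Fin.last N))) = S.val i := by
    intro i
    show (if i = S.root then 1 else ∑ j ∈ Finset.range N, term i j) = _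
    split_ifs with hi
    · rw [hi, S.val_root]
    · rw [hval i hi, Finset.sum_range, ← Equiv.sum_comp e]
      exact Finset.sum_congr rfl fun j _ => by simp [term]
  have h1 : IsInputLabel (1 : MvPolynomial σ ℚ) := Or.inl rfl
  have hcard : Fintype.card V = N * (N + 1) + N * N + 3 := by
    simp [V, hN, SkewSystem.size]
  rw [← hcard, ← hlast o]
  refine exists_algCircuit_of_program rank val ?_ _
  rintro ((⟨i, ⟨k, hk⟩⟩ | ⟨i, k⟩) | (_ | b))
  · by_cases hi : i = S.root
    · left
      simpa [val, hi] using h1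
    right
    rcases k with _ | k
    · right
      exact ⟨1, .inr none, h1, by simp [rank], by simp [val, hi]⟩
    · have hk' : k < N := by omega
      by_cases h0 : c i (e ⟨k, hk'⟩) = 0
      · right
        refine ⟨1, .inl (.inl (i, ⟨k, by omega⟩)), h1, by simp [rank], ?_⟩
        simp [val, hi, Finset.sum_range_succ, term, hk', h0]
      · left
        refine ⟨.inl (.inl (i, ⟨k, by omega⟩)), .inl (.inr (i, ⟨k, hk'⟩)),
          fun h => Sum.inl_ne_inr (Sum.inl_injective h),
          by simp [rank], ?_, ?_⟩
        · have h2 := (hc i (e ⟨k, hk'⟩)).2 h0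
          have h3 : (S.rank (e ⟨k, hk'⟩) + 1) * (N + 1) ≤ S.rank i * (N + 1) :=
            Nat.mul_le_mul_right _ h2
          simp only [rank, Sum.elim_inl, Sum.elim_inr]
          rw [add_mul] at h3
          omega
        · simp [val, hi, Finset.sum_range_succ, term, hk', h0]
  · by_cases h0 : c i (e k) = 0
    · left
      simpa [val, h0] using h1
    · right
      right
      refine ⟨c i (e k), .inl (.inl (e k, Fin.last N)), (hc _ _).1.isInputLabel h0,
        by simp [rank], ?_⟩
      rw [hlast]
      simp [val, h0]
  · right
    left
    exact ⟨.inr (some true), .inr (some false), fun h => absurd (Sum.inr_injective h) (by simp), by simp [rank], by simp [rank],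
      by simp [val]⟩
  · left
    rcases b with _ | _ <;> simp [val, IsInputLabel]

/-! ### Polynomial bounds and the two equalities -/

/-- A polynomial bound of one complexity measure in terms of another one. -/
theorem PolynomiallyBounded.of_le {c d : ℕ → ℕ∞} (q : Polynomial ℕ)
    (h : ∀ m n : ℕ, c m ≤ n → d m ≤ ((q.eval n : ℕ) : ℕ∞)) (hc : PolynomiallyBounded c) :
    PolynomiallyBounded d := by
  obtain ⟨p, hp⟩ := hc
  exact ⟨q.comp p, fun m => by simpa using h m _ (hp m)⟩

/-- Bounding by `n` is bounding strictly by `n + 1`, and a strict bound on an infimum is witnessed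
by a member of the family. -/
theorem exists_le_of_iInf_le {α : Type*} {P : α → Prop} {s : α → ℕ} {n : ℕ}
    (h : ⨅ (a : α) (_ : P a), (s a : ℕ∞) ≤ n) : ∃ a, P a ∧ s a ≤ n := by
  have h2 : ⨅ (a : α) (_ : P a), (s a : ℕ∞) < (n + 1 : ℕ) :=
    h.trans_lt (by exact_mod_cast n.lt_succ_self)
  simp only [iInf_lt_iff] at h2
  obtain ⟨a, ha, h3⟩ := h2
  exact ⟨a, ha, Nat.lt_succ_iff.1 (by exact_mod_cast h3)⟩

open Polynomial in
theorem exists_algCircuit_of_bdc_le {σ : Type*} : ∃ q : ℕ[X], ∀ (f : MvPolynomial σ ℚ) (n : ℕ),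
    bdc f ≤ n → ∃ C : AlgCircuit σ, C.IsConstantFree ∧ C.IsSkew ∧ C.IsWeaklySkew ∧
      C.Computes f ∧ C.size ≤ q.eval n := by
  refine ⟨(fun N : ℕ[X] => 2 * (N * (N + 1) + N * N + 3)) ((X + 1) * ((X + 1) * (X + 2))),
    fun f n h => ?_⟩
  have h2 : bdc f < (n + 1 : ℕ) := h.trans_lt (by exact_mod_cast n.lt_succ_self)
  simp only [bdc, iInf_lt_iff] at h2
  obtain ⟨k, A, ⟨hA, rfl⟩, hk⟩ := h2
  have hk : k ≤ n := Nat.lt_succ_iff.1 (by exact_mod_cast hk)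
  obtain ⟨S, o, ho, hs⟩ := exists_skewSystem_of_det hA
  obtain ⟨C, h1, h2, h3, h4, h5⟩ := S.exists_algCircuit o
  refine ⟨C, h1, h2, h3, ho ▸ h4, h5.trans ?_⟩
  have hs' : S.size ≤ (n + 1) * ((n + 1) * (n + 2)) := by rw [hs]; gcongr
  simp only [eval_mul, eval_add, eval_X, eval_one, eval_ofNat]
  gcongr

theorem mainTheorem2 (σ : Type*) : VPs₀ σ = DET₀ σ ∧ VPws₀ σ = DET₀ σ := by
  obtain ⟨q, hq⟩ := exists_algCircuit_of_bdc_le (σ := σ)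
  refine ⟨Set.Subset.antisymm (fun f hf => ?_) fun f hf => ?_,
    Set.Subset.antisymm (fun f hf => ?_) fun f hf => ?_⟩
  · refine PolynomiallyBounded.of_le (2 * (Polynomial.X + 1)) (fun m n h => ?_) hf
    obtain ⟨C, ⟨h1, h2, h3⟩, h4⟩ := exists_le_of_iInf_le h
    have := C.bdc_le_of_isSkew h1 h2
    rw [h3] at this
    refine this.trans (Nat.cast_le.2 ?_)
    simpa using h4
  · refine PolynomiallyBounded.of_le q (fun m n h => ?_) hf
    obtain ⟨C, h1, h2, h3, h4, h5⟩ := hq _ _ h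
    exact iInf₂_le_of_le C ⟨h1, h2, h4⟩ (Nat.cast_le.2 h5)
  · refine PolynomiallyBounded.of_le (2 * (Polynomial.X + 1)) (fun m n h => ?_) hf
    obtain ⟨C, ⟨h1, h2, h3⟩, h4⟩ := exists_le_of_iInf_le h
    have := C.bdc_le_of_isWeaklySkew h1 h2
    rw [h3] at this
    refine this.trans (Nat.cast_le.2 ?_)
    simpa using h4
  · refine PolynomiallyBounded.of_le q (fun m n h => ?_) hf
    obtain ⟨C, h1, h2, h3, h4, h5⟩ := hq _ _ h
    exact iInf₂_le_of_le C ⟨h1, h3, h4⟩ (Nat.cast_le.2 h5)
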